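/- Call a finite simple graph $G$ planar if it can be drawn in the Euclidean plane so that its edges do not cross: distinct vertices are represented by distinct points, each edge is represented by a simple arc (the image of an injective continuous curve) that joins its two end vertices and contains no other vertex, and two different edges have no point in common except possibly a common end vertex. Let $G$ be a simple connected planar graph with $n$ vertices and $m$ edges, where $n\ge 3$. Then $m\le 3n-6$. -/

import Mathlib

/-- The Euclidean plane. -/
abbrev Plane : Type := EuclideanSpace ℝ (Fin 2)

/-- `A` is a simple arc in the plane with end points `x` and `y`: the image of an injective
continuous curve, parametrized by the unit interval, that runs from `x` to `y`. -/
def IsSimpleArc (x y : Plane) (A : Set Plane) : Prop :=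
  ∃ γ : Path x y, Function.Injective γ ∧ Set.range γ = A

/-- A drawing of the graph `G` in the plane without edge crossings. Vertices are distinct points,
an edge is a simple arc that joins its two end vertices and passes through no other vertex, and
two different edges meet in points of vertices only (hence only in common end vertices). -/
structure PlaneDrawing {V : Type*} (G : SimpleGraph V) where
  /-- the point that represents a vertex -/
  point : V → Plane
  /-- the arc that represents an edge -/
  arc : G.edgeSet → Set Plane
  point_injective : Function.Injective point
  isSimpleArc : ∀ (u v : V) (h : G.Adj u v), IsSimpleArc (point u) (point v) (arc ⟨s(u, v), h⟩)
  mem_of_point_mem_arc : ∀ (e : G.edgeSet) (v : V), point v ∈ arc e → v ∈ (e : Sym2 V)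
  arc_inter_arc_subset : ∀ e f : G.edgeSet, e ≠ f → arc e ∩ arc f ⊆ Set.range point

/-- A graph is planar if it can be drawn in the plane so that its edges do not cross. -/
def IsPlanar {V : Type*} (G : SimpleGraph V) : Prop :=
  Nonempty (PlaneDrawing G)

/-! Only a weak consequence of planarity is used: vertex-disjoint edges have disjoint images. This
property passes to subgraphs and, unlike a drawing without crossings, survives edge contraction with
almost no topology (`IsWeaklyDrawable.mergeInto`).

It excludes `K₅` by a parity argument in the style of van Kampen (`not_exists_paths_five`). For
disjoint edges the difference of their parametrizations vanishes nowhere on the square, so the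
winding of each edge about the ends of the other obeys an integer relation; for `K₅` these relations
are inconsistent mod 2.

The rest is induction on the number of vertices. With `3n - 5` edges, deletion and contraction force
minimum degree 4 and three common neighbours for the ends of each edge. Some vertex has degree at
most 5, and its neighbourhood yields `K₅`, possibly after one contraction. -/

/-! ### Continuous logarithms along curves -/

open unitInterval in
/-- A nowhere vanishing continuous function on the unit square has a continuous logarithm. -/
theorem exists_continuous_log_square (H : C(I × I, ℂ)) (hH : ∀ x, H x ≠ 0) :
    ∃ L : C(I × I, ℂ), ∀ x, Complex.exp (L x) = H x := by
  have cov := Complex.isCoveringMap_exp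
  let H' : C(I × I, {z : ℂ // z ≠ 0}) := ⟨fun x => ⟨H x, hH x⟩, by fun_prop⟩
  let h₀ : C(I, {z : ℂ // z ≠ 0}) := H'.comp ⟨fun t => (0, t), by fun_prop⟩
  have e₀ : h₀ 0 = ⟨_, (Complex.log (H (0, 0))).exp_ne_zero⟩ :=
    Subtype.ext (Complex.exp_log (hH _)).symm
  have lifts := cov.liftPath_lifts h₀ _ e₀
  refine ⟨cov.liftHomotopy H' (cov.liftPath h₀ _ e₀) fun a => (congr_fun lifts a).symm, fun x => ?_⟩
  exact congr_arg Subtype.val (congr_fun (cov.liftHomotopy_lifts H' _ _) x)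

open unitInterval in
/-- Two continuous logarithms of the same curve have the same increment. -/
theorem log_increment_unique {L L' : I → ℂ} (hL : Continuous L) (hL' : Continuous L')
    (h : ∀ t, Complex.exp (L t) = Complex.exp (L' t)) : L 1 - L 0 = L' 1 - L' 0 := by
  have hc : ∀ t, Complex.exp (L t - L' t) = Complex.exp 0 := fun t => by
    rw [Complex.exp_sub, h t, div_self (Complex.exp_ne_zero _), Complex.exp_zero]
  have key := Complex.isCoveringMap_exp.const_of_comp (hL.sub hL')
    (fun a a' => Subtype.ext ((hc a).trans (hc a').symm)) 1 0
  simp only [Pi.sub_apply] at key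
  linear_combination key

open unitInterval in
/-- The increment of a continuous logarithm along a curve, with junk value `0` if there is no
continuous logarithm. -/
noncomputable def logIncrement (g : I → ℂ) : ℂ :=
  open Classical in
  if h : ∃ L : I → ℂ, Continuous L ∧ ∀ t, Complex.exp (L t) = g t then h.choose 1 - h.choose 0
  else 0

open unitInterval in
theorem logIncrement_eq {g L : I → ℂ} (hL : Continuous L) (h : ∀ t, Complex.exp (L t) = g t) :
    logIncrement g = L 1 - L 0 := by
  have hex : ∃ L : I → ℂ, Continuous L ∧ ∀ t, Complex.exp (L t) = g t := ⟨L, hL, h⟩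
  rw [logIncrement, dif_pos hex]
  exact log_increment_unique hex.choose_spec.1 hL fun t => (hex.choose_spec.2 t).trans (h t).symm

open unitInterval in
/-- The increments of the logarithm along the two ways around the square agree. -/
theorem logIncrement_square (H : C(I × I, ℂ)) (hH : ∀ x, H x ≠ 0) :
    logIncrement (fun s => H (s, 0)) + logIncrement (fun t => H (1, t)) =
      logIncrement (fun t => H (0, t)) + logIncrement (fun s => H (s, 1)) := by
  obtain ⟨L, hL⟩ := exists_continuous_log_square H hH
  rw [logIncrement_eq (L := fun s => L (s, 0)) (by fun_prop) fun _ => hL _,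
    logIncrement_eq (L := fun t => L (1, t)) (by fun_prop) fun _ => hL _,
    logIncrement_eq (L := fun t => L (0, t)) (by fun_prop) fun _ => hL _,
    logIncrement_eq (L := fun s => L (s, 1)) (by fun_prop) fun _ => hL _]
  ring

open unitInterval in
theorem exists_continuous_log_curve (g : C(I, ℂ)) (hg : ∀ t, g t ≠ 0) :
    ∃ L : C(I, ℂ), ∀ t, Complex.exp (L t) = g t := by
  obtain ⟨L, hL⟩ := exists_continuous_log_square (g.comp ⟨Prod.fst, continuous_fst⟩) fun x => hg _
  exact ⟨L.comp ⟨fun t => (t, 0), by fun_prop⟩, fun t => hL (t, 0)⟩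

open unitInterval in
theorem exp_logIncrement (g : C(I, ℂ)) (hg : ∀ t, g t ≠ 0) :
    Complex.exp (logIncrement g) = g 1 / g 0 := by
  obtain ⟨L, hL⟩ := exists_continuous_log_curve g hg
  rw [logIncrement_eq L.continuous hL, Complex.exp_sub, hL, hL]

open unitInterval in
theorem logIncrement_neg (g : C(I, ℂ)) (hg : ∀ t, g t ≠ 0) :
    logIncrement (fun t => -g t) = logIncrement g := by
  obtain ⟨L, hL⟩ := exists_continuous_log_curve g hg
  rw [logIncrement_eq L.continuous hL,
    logIncrement_eq (L := fun t => L t + Real.pi * Complex.I) (by fun_prop) fun t => by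
      rw [Complex.exp_add, hL, Complex.exp_pi_mul_I]; ring]
  ring

/-! ### Nonplanarity of `K₅` -/

/-- The complete graph on five vertices has no map to the plane under which vertex-disjoint edges
have disjoint images. -/
theorem not_exists_paths_five (p : Fin 5 → ℂ) (γ : ∀ i j, i < j → Path (p i) (p j))
    (hγ : ∀ i j k l (hij : i < j) (hkl : k < l), i ≠ k → i ≠ l → j ≠ k → j ≠ l →
      ∀ s t, γ i j hij s ≠ γ k l hkl t) : False := by
  -- edges miss the other vertices
  have hpt : ∀ i j k (hij : i < j), i ≠ k → j ≠ k → ∀ s, γ i j hij s ≠ p k := by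
    intro i j k hij hik hjk s h
    obtain ⟨l, hl⟩ := (by decide : ∀ i j k : Fin 5, ∃ l, l ≠ i ∧ l ≠ j ∧ l ≠ k) i j k
    rcases lt_or_gt_of_ne hl.2.2 with hlk | hkl
    · exact hγ i j l k hij hlk hl.1.symm hik hl.2.1.symm hjk s 1 (by simpa using h)
    · exact hγ i j k l hij hkl hik hl.1.symm hjk hl.2.1.symm s 0 (by simpa using h)
  have hp : ∀ i j, i ≠ j → p i - p j ≠ 0 := by
    intro i j hij h
    obtain ⟨l, hli, hlj⟩ := (by decide : ∀ i j : Fin 5, ∃ l, l ≠ i ∧ l ≠ j) i j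
    rcases lt_or_gt_of_ne hli with hl | hl
    · exact hpt l i j hl hlj hij 1 (by simpa using sub_eq_zero.1 h)
    · exact hpt i l j hl hij hlj 0 (by simpa using sub_eq_zero.1 h)
  -- arguments of the differences of the vertices
  obtain ⟨φ, hφ, hφs⟩ : ∃ φ : Fin 5 → Fin 5 → ℂ,
      (∀ i j, i ≠ j → Complex.exp (φ i j) = p i - p j) ∧
      ∀ i j, i < j → φ j i = φ i j + Real.pi * Complex.I := by
    refine ⟨fun i j => if i < j then Complex.log (p i - p j) else
      Complex.log (p j - p i) + Real.pi * Complex.I, fun i j hij => ?_, fun i j hij => ?_⟩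
    · dsimp only
      split_ifs with h
      · exact Complex.exp_log (hp i j hij)
      · rw [Complex.exp_add, Complex.exp_log (hp j i hij.symm), Complex.exp_pi_mul_I]; ring
    · simp [hij, hij.not_gt]
  -- The integer counts the full turns of edge `ij` about `p k` relative to the reference
  -- logarithms. It is quantified before the hypotheses so that `choose` gives a function of the
  -- indices alone.
  have hθ : ∀ i j k, ∃ n : ℤ, ∀ hij : i < j, i ≠ k → j ≠ k →
      logIncrement (fun s => γ i j hij s - p k) =
        φ j k - φ i k + n * (2 * Real.pi * Complex.I) := by
    intro i j k
    by_cases h : i < j ∧ i ≠ k ∧ j ≠ k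
    · obtain ⟨hij, hik, hjk⟩ := h
      have := exp_logIncrement ⟨fun s => γ i j hij s - p k, by fun_prop⟩
        fun s => sub_ne_zero.2 (hpt i j k hij hik hjk s)
      simp only [ContinuousMap.coe_mk, Path.target, Path.source] at this
      rw [← hφ i k hik, ← hφ j k hjk, ← Complex.exp_sub, Complex.exp_eq_exp_iff_exists_int] at this
      obtain ⟨n, hn⟩ := this
      exact ⟨n, fun _ _ _ => hn⟩
    · exact ⟨0, fun h1 h2 h3 => absurd ⟨h1, h2, h3⟩ h⟩
  choose N hN using hθ
  have hsq : ∀ i j k l, i < j → k < l → i ≠ k → i ≠ l → j ≠ k → j ≠ l →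
      φ j k - φ i k - φ j l + φ i l - φ l i + φ k i + φ l j - φ k j
        + ((N i j k - N i j l - N k l i + N k l j : ℤ) : ℂ) * (2 * Real.pi * Complex.I) = 0 := by
    intro i j k l hij hkl hik hil hjk hjl
    have h := logIncrement_square
      ⟨fun x => γ i j hij x.1 - γ k l hkl x.2, by fun_prop⟩
      fun x => sub_ne_zero.2 (hγ i j k l hij hkl hik hil hjk hjl x.1 x.2)
    have e1 := logIncrement_neg ⟨fun t => γ k l hkl t - p i, by fun_prop⟩
      fun t => sub_ne_zero.2 (hpt k l i hkl hik.symm hil.symm t)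
    have e2 := logIncrement_neg ⟨fun t => γ k l hkl t - p j, by fun_prop⟩
      fun t => sub_ne_zero.2 (hpt k l j hkl hjk.symm hjl.symm t)
    simp only [ContinuousMap.coe_mk, Path.target, Path.source, neg_sub] at h e1 e2
    rw [e1, e2, hN i j k hij hik hjk, hN i j l hij hil hjl, hN k l i hkl hik.symm hil.symm,
      hN k l j hkl hjk.symm hjl.symm] at h
    push_cast
    linear_combination h
  have hpi : (Real.pi * Complex.I : ℂ) ≠ 0 := by simp [Real.pi_ne_zero]
  have hcancel : ∀ m : ℤ, (m : ℂ) * (Real.pi * Complex.I) = 0 → m = 0 := fun m h => by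
    simpa [hpi, Real.pi_ne_zero] using h
  -- the three ways to split a set of four vertices into two edges
  have side : ∀ i j k l, i < j → j < k → k < l →
      N i j k - N i j l - N k l i + N k l j = 0 := by
    intro i j k l hij hjk hkl
    have hik := hij.trans hjk
    have hjl := hjk.trans hkl
    have hil := hij.trans hjl
    have h := hsq i j k l hij hkl hik.ne hil.ne hjk.ne hjl.ne
    rw [hφs i k hik, hφs i l hil, hφs j k hjk, hφs j l hjl] at h
    have := hcancel (2 * (N i j k - N i j l - N k l i + N k l j)) (by
      push_cast at h ⊢; linear_combination h)
    omega
  have nested : ∀ i j k l, i < j → j < k → k < l →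
      N i l j - N i l k - N j k i + N j k l = 0 := by
    intro i j k l hij hjk hkl
    have hik := hij.trans hjk
    have hjl := hjk.trans hkl
    have hil := hij.trans hjl
    have h := hsq i l j k hil hjk hij.ne hik.ne hjl.ne' hkl.ne'
    rw [hφs i k hik, hφs i j hij, hφs k l hkl, hφs j l hjl] at h
    have := hcancel (2 * (N i l j - N i l k - N j k i + N j k l)) (by
      push_cast at h ⊢; linear_combination h)
    omega
  -- For interleaved pairs the four `πi` corrections have signs `+++-` and leave `2πi`; in the other
  -- two splittings they cancel.
  have crossing : ∀ i j k l, i < j → j < k → k < l →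
      N i k j - N i k l - N j l i + N j l k = -1 := by
    intro i j k l hij hjk hkl
    have hik := hij.trans hjk
    have hjl := hjk.trans hkl
    have hil := hij.trans hjl
    have h := hsq i k j l hik hjl hij.ne hil.ne hjk.ne' hkl.ne
    rw [hφs i l hil, hφs i j hij, hφs k l hkl, hφs j k hjk] at h
    have := hcancel (2 * (N i k j - N i k l - N j l i + N j l k) + 2) (by
      push_cast at h ⊢; linear_combination h)
    omega
  have all := fun i j k l hij hjk hkl =>
    And.intro (side i j k l hij hjk hkl) (And.intro (nested i j k l hij hjk hkl)
      (crossing i j k l hij hjk hkl))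
  -- Each `N i j k` occurs in exactly two of the fifteen relations, with coefficients `±1`, so the
  -- left sides have an even sum; the right sides add up to `-5`.
  have a0 := all 1 2 3 4 (by decide) (by decide) (by decide)
  have a1 := all 0 2 3 4 (by decide) (by decide) (by decide)
  have a2 := all 0 1 3 4 (by decide) (by decide) (by decide)
  have a3 := all 0 1 2 4 (by decide) (by decide) (by decide)
  have a4 := all 0 1 2 3 (by decide) (by decide) (by decide)
  omega

/-! ### Weak drawability and edge contraction -/

open Finset

/-- A graph is weakly drawable if its vertices can be sent to points and its edges to sets joining
the end points in the plane so that vertex-disjoint edges are sent to disjoint sets. -/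
def IsWeaklyDrawable {V : Type*} (G : SimpleGraph V) : Prop :=
  ∃ (p : V → ℂ) (Y : V → V → Set ℂ), (∀ u v, G.Adj u v → JoinedIn (Y u v) (p u) (p v)) ∧
    ∀ a b c d, G.Adj a b → G.Adj c d → a ≠ c → a ≠ d → b ≠ c → b ≠ d → Disjoint (Y a b) (Y c d)

theorem IsWeaklyDrawable.mono {V : Type*} {G H : SimpleGraph V} (h : H ≤ G)
    (hG : IsWeaklyDrawable G) : IsWeaklyDrawable H := by
  obtain ⟨p, Y, hY, hd⟩ := hG
  exact ⟨p, Y, fun u v e => hY u v (h e), fun a b c d e f => hd a b c d (h e) (h f)⟩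

theorem IsWeaklyDrawable.cliqueFree_five {V : Type*} {G : SimpleGraph V}
    (hG : IsWeaklyDrawable G) : G.CliqueFree 5 := by
  by_contra h
  obtain ⟨f⟩ := SimpleGraph.not_cliqueFree_iff_top_isContained 5 |>.1 h
  obtain ⟨p, Y, hY, hd⟩ := hG
  have hadj : ∀ i j : Fin 5, i ≠ j → G.Adj (f i) (f j) := fun i j hij =>
    f.toHom.map_adj hij
  refine not_exists_paths_five (p ∘ f) (fun i j hij => (hY _ _ (hadj i j hij.ne)).somePath) ?_
  intro i j k l hij hkl hik hil hjk hjl s t he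
  refine Set.disjoint_left.1 (hd _ _ _ _ (hadj i j hij.ne) (hadj k l hkl.ne)
    (f.injective.ne hik) (f.injective.ne hil) (f.injective.ne hjk) (f.injective.ne hjl))
    ((hY _ _ (hadj i j hij.ne)).somePath_mem s) ?_
  rw [he]
  exact (hY _ _ (hadj k l hkl.ne)).somePath_mem t

/-- A common point of two distinct arcs is a vertex, and a vertex on an arc is an end of that edge.
-/
theorem IsPlanar.isWeaklyDrawable {V : Type*} {G : SimpleGraph V} (hG : IsPlanar G) :
    IsWeaklyDrawable G := by
  classical
  obtain ⟨D⟩ := hG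
  let Φ := Complex.orthonormalBasisOneI.repr.symm
  refine ⟨fun v => Φ (D.point v),
    fun u v => if h : G.Adj u v then Φ '' D.arc ⟨s(u, v), h⟩ else ∅, fun u v h => ?_, ?_⟩
  · simp only [dif_pos h]
    obtain ⟨γ, -, hγ⟩ := D.isSimpleArc u v h
    refine ⟨γ.map Φ.continuous, fun t => ⟨γ t, hγ ▸ Set.mem_range_self t, rfl⟩⟩
  · intro a b c d hab hcd hac had hbc hbd
    simp only [dif_pos hab, dif_pos hcd]
    refine (Set.disjoint_image_iff Φ.injective).2 (Set.disjoint_left.2 fun x hx hx' => ?_)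
    have hne : (⟨s(a, b), hab⟩ : G.edgeSet) ≠ ⟨s(c, d), hcd⟩ := fun h => by
      have := congr_arg Subtype.val h
      simp only [Sym2.eq_iff] at this
      tauto
    obtain ⟨v, rfl⟩ := D.arc_inter_arc_subset _ _ hne ⟨hx, hx'⟩
    have h1 := Sym2.mem_iff.1 (D.mem_of_point_mem_arc _ _ hx)
    have h2 := Sym2.mem_iff.1 (D.mem_of_point_mem_arc _ _ hx')
    rcases h1 with rfl | rfl <;> rcases h2 with rfl | rfl <;> contradiction

/-- The graph obtained by moving all edges at `b` to `a`, which isolates `b`. -/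
def SimpleGraph.mergeInto {V : Type*} (G : SimpleGraph V) (a b : V) : SimpleGraph V where
  Adj x y := x ≠ y ∧ x ≠ b ∧ y ≠ b ∧ (G.Adj x y ∨ (x = a ∧ G.Adj b y) ∨ (y = a ∧ G.Adj x b))
  symm := ⟨fun x y h => ⟨h.1.symm, h.2.2.1, h.2.1, by
    rcases h.2.2.2 with h | h | h
    · exact .inl h.symm
    · exact .inr (.inr ⟨h.1, h.2.symm⟩)
    · exact .inr (.inl ⟨h.1, h.2.symm⟩)⟩⟩
  loopless := ⟨fun _ h => h.1 rfl⟩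

/-- A new edge at `a` runs along `ab` and then along the old edge at `b`. Of two vertex-disjoint
edges at most one contains `a`; the other avoids both `a` and `b`, hence misses both pieces. New
edges may overlap along `ab`, but they share the vertex `a`. -/
theorem IsWeaklyDrawable.mergeInto {V : Type*} {G : SimpleGraph V}
    (hG : IsWeaklyDrawable G) {a b : V} (hab : G.Adj a b) :
    IsWeaklyDrawable (G.mergeInto a b) := by
  classical
  obtain ⟨p, Y, hY, hd⟩ := hG
  refine ⟨p, fun x y => if G.Adj x y then Y x y else if x = a then Y a b ∪ Y b y else
    Y x b ∪ Y b a, fun x y h => ?_, ?_⟩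
  · obtain ⟨hxy, hxb, hyb, h⟩ := h
    dsimp only
    split_ifs with h1 h2
    · exact hY x y h1
    · subst h2
      have hby : G.Adj b y := by
        rcases h with h | h | h
        · exact absurd h h1
        · exact h.2
        · exact absurd h.1.symm hxy
      exact ((hY _ _ hab).mono Set.subset_union_left).trans
        ((hY _ _ hby).mono Set.subset_union_right)
    · have hya : y = a ∧ G.Adj x b := by
        rcases h with h | h | h
        · exact absurd h h1
        · exact absurd h.1 h2
        · exact h
      obtain ⟨rfl, hxb'⟩ := hya
      exact ((hY _ _ hxb').mono Set.subset_union_left).trans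
        ((hY _ _ hab.symm).mono Set.subset_union_right)
  · rintro x y z w ⟨hxy, hxb, hyb, h⟩ ⟨hzw, hzb, hwb, h'⟩ hxz hxw hyz hyw
    dsimp only
    have hba := hab.symm
    split_ifs with h1 h2 h3 h4 h5 <;>
      grind [Set.disjoint_union_left, Set.disjoint_union_right]

/-- Contraction loses the edge `ab` and identifies two edges for each common neighbour. -/
theorem SimpleGraph.card_edgeFinset_le_mergeInto {V : Type*} [Fintype V] [DecidableEq V]
    (G : SimpleGraph V) [DecidableRel G.Adj] (a b : V) [DecidableRel (G.mergeInto a b).Adj]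
    (hab : G.Adj a b) :
    #G.edgeFinset ≤
      #(G.mergeInto a b).edgeFinset + 1 + #(G.neighborFinset a ∩ G.neighborFinset b) := by
  set T := G.neighborFinset b \ (G.neighborFinset a ∪ {a}) with hT
  have h1 := G.card_edgeFinset_deleteIncidenceSet b
  have hinj : #(T.image fun y => s(a, y)) = #T := by
    refine card_image_of_injective _ fun x y h => ?_
    exact Sym2.congr_right.1 h
  have hdisj : Disjoint (G.deleteIncidenceSet b).edgeFinset (T.image fun y => s(a, y)) := by
    rw [disjoint_right]
    intro e he he'
    obtain ⟨y, hy, rfl⟩ := mem_image.1 he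
    rw [SimpleGraph.mem_edgeFinset, SimpleGraph.mem_edgeSet,
      SimpleGraph.deleteIncidenceSet_adj] at he'
    simp [hT, he'.1] at hy
  have hsub : (G.deleteIncidenceSet b).edgeFinset ∪ (T.image fun y => s(a, y)) ⊆
      (G.mergeInto a b).edgeFinset := by
    refine union_subset ?_ fun e he => ?_
    · intro e
      induction e with | _ x y
      rw [SimpleGraph.mem_edgeFinset, SimpleGraph.mem_edgeSet, SimpleGraph.deleteIncidenceSet_adj,
        SimpleGraph.mem_edgeFinset, SimpleGraph.mem_edgeSet]
      exact fun h => ⟨h.1.ne, h.2.1, h.2.2, .inl h.1⟩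
    · obtain ⟨y, hy, rfl⟩ := mem_image.1 he
      rw [SimpleGraph.mem_edgeFinset, SimpleGraph.mem_edgeSet]
      simp only [hT, mem_sdiff, SimpleGraph.mem_neighborFinset, mem_union, mem_singleton] at hy
      exact ⟨fun h => hy.2 (.inr h.symm), hab.ne, hy.1.ne', .inr (.inl ⟨rfl, hy.1⟩)⟩
  have h2 := card_le_card hsub
  rw [card_union_of_disjoint hdisj, hinj] at h2
  have h3 : #(G.neighborFinset b) ≤ #T + 1 + #(G.neighborFinset a ∩ G.neighborFinset b) := by
    have : G.neighborFinset b ⊆ T ∪ {a} ∪ (G.neighborFinset a ∩ G.neighborFinset b) := by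
      intro x hx
      simp only [hT, mem_union, mem_sdiff, mem_inter, mem_singleton]
      tauto
    refine (card_le_card this).trans ((card_union_le _ _).trans ?_)
    gcongr
    exact (card_union_le _ _).trans (by simp)
  rw [SimpleGraph.card_neighborFinset_eq_degree] at h3
  -- Needed because `h1` contains a truncated subtraction.
  have h4 : G.degree b ≤ #G.edgeFinset := by
    rw [← SimpleGraph.card_incidenceFinset_eq_degree]
    exact card_le_card (G.incidenceFinset_subset b)
  omega

/-! ### The extremal argument -/

theorem SimpleGraph.not_cliqueFree_five_of_adj {V : Type*} {G : SimpleGraph V} {v a b c d : V}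
    (hva : G.Adj v a) (hvb : G.Adj v b) (hvc : G.Adj v c) (hvd : G.Adj v d) (hab : G.Adj a b)
    (hac : G.Adj a c) (had : G.Adj a d) (hbc : G.Adj b c) (hbd : G.Adj b d) (hcd : G.Adj c d) :
    ¬ G.CliqueFree 5 := by
  classical
  intro h
  refine h {v, a, b, c, d} ⟨?_, ?_⟩
  · simp [SimpleGraph.isClique_iff, *]
  · rw [card_insert_of_notMem, card_insert_of_notMem, card_insert_of_notMem, card_insert_of_notMem,
      card_singleton]
    all_goals simp only [mem_insert, mem_singleton, not_or]
    all_goals simp [hva.ne, hvb.ne, hvc.ne, hvd.ne, hab.ne, hac.ne, had.ne, hbc.ne, hbd.ne, hcd.ne]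

/-- In a graph with five vertices and minimum degree three, some two vertices are joined to all of
the three others, one of which is joined to the other two. -/
theorem exists_adj_of_five {V : Type*} [DecidableEq V] (G : SimpleGraph V) [DecidableRel G.Adj]
    (N : Finset V) (hN : #N = 5) (hdeg : ∀ x ∈ N, 3 ≤ #{y ∈ N | G.Adj x y}) :
    ∃ a ∈ N, ∃ b ∈ N, ∃ c ∈ N, ∃ d ∈ N, ∃ e ∈ N, a ≠ b ∧ G.Adj a c ∧ G.Adj a d ∧ G.Adj a e ∧
      G.Adj b c ∧ G.Adj b d ∧ G.Adj b e ∧ G.Adj e c ∧ G.Adj e d ∧ c ≠ d := by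
  -- Inside `N` the non-adjacent pairs form a matching; `a` and `b` will be one such pair, if there
  -- is any.
  have huniq : ∀ x ∈ N, ∀ y ∈ N, ∀ z ∈ N, y ≠ x → z ≠ x → ¬ G.Adj x y → ¬ G.Adj x z → y = z := by
    intro x hx y hy z hz hyx hzx hxy hxz
    by_contra hyz
    have hsub : {w ∈ N | G.Adj x w} ⊆ ((N.erase x).erase y).erase z := by
      intro w hw
      rw [mem_filter] at hw
      simp only [mem_erase]
      refine ⟨?_, ?_, hw.2.ne', hw.1⟩ <;> rintro rfl
      · exact hxz hw.2
      · exact hxy hw.2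
    have := card_le_card hsub
    rw [card_erase_of_mem (by simp [*, Ne.symm hyz]), card_erase_of_mem (by simp [*]),
      card_erase_of_mem hx, hN] at this
    have := hdeg x hx
    omega
  obtain ⟨a, ha, b, hb, hab, hnb⟩ : ∃ a ∈ N, ∃ b ∈ N, a ≠ b ∧
      ∀ y ∈ N, y ≠ a → y ≠ b → G.Adj a y ∧ G.Adj b y := by
    by_cases h : ∃ a ∈ N, ∃ b ∈ N, a ≠ b ∧ ¬ G.Adj a b
    · obtain ⟨a, ha, b, hb, hab, hn⟩ := h
      exact ⟨a, ha, b, hb, hab, fun y hy hya hyb =>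
        ⟨by_contra fun h => hyb (huniq a ha y hy b hb hya hab.symm h hn),
          by_contra fun h => hya (huniq b hb y hy a ha hyb hab h fun h => hn h.symm)⟩⟩
    · push Not at h
      obtain ⟨a, ha, b, hb, hab⟩ := one_lt_card.1 (by omega : 1 < #N)
      exact ⟨a, ha, b, hb, hab, fun y hy hya hyb => ⟨h a ha y hy hya.symm, h b hb y hy hyb.symm⟩⟩
  obtain ⟨c, d, e, hcd, hce, hde, hcde⟩ := card_eq_three.1
    (by rw [card_erase_of_mem (by simp [hab.symm, hb]), card_erase_of_mem ha, hN] :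
      #((N.erase a).erase b) = 3)
  have hmem : ∀ x, x = c ∨ x = d ∨ x = e → x ∈ N ∧ G.Adj a x ∧ G.Adj b x := by
    intro x hx
    have : x ∈ (N.erase a).erase b := by rw [hcde]; simpa using hx
    simp only [mem_erase] at this
    exact ⟨this.2.2, hnb x this.2.2 this.2.1 this.1⟩
  obtain ⟨hc, hac, hbc⟩ := hmem c (by simp)
  obtain ⟨hd, had, hbd⟩ := hmem d (by simp)
  obtain ⟨he, hae, hbe⟩ := hmem e (by simp)
  by_cases hec : G.Adj e c
  · by_cases hed : G.Adj e d
    · exact ⟨a, ha, b, hb, c, hc, d, hd, e, he, hab, hac, had, hae, hbc, hbd, hbe, hec, hed, hcd⟩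
    · have hcd' : G.Adj c d := by_contra fun h =>
        hce (huniq d hd c hc e he hcd hde.symm (fun h' => h h'.symm) fun h' => hed h'.symm)
      exact ⟨a, ha, b, hb, e, he, d, hd, c, hc, hab, hae, had, hac, hbe, hbd, hbc, hec.symm, hcd',
        hde.symm⟩
  · have hdc : G.Adj d c := by_contra fun h =>
      hde (huniq c hc d hd e he hcd.symm hce.symm (fun h' => h h'.symm) fun h' => hec h'.symm)
    have hde' : G.Adj d e := by_contra fun h =>
      hcd (huniq e he c hc d hd hce hde hec fun h' => h h'.symm)
    exact ⟨a, ha, b, hb, c, hc, e, he, d, hd, hab, hac, hae, had, hbc, hbe, hbd, hdc, hde', hce⟩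

/-- The set `S` lets the induction stay on one vertex type: deleted or merged vertices remain,
isolated, outside `S`. -/
theorem IsWeaklyDrawable.card_edgeFinset_add_six_le {V : Type*} [Fintype V] [DecidableEq V]
    (k : ℕ) : ∀ (S : Finset V) (G : SimpleGraph V) [DecidableRel G.Adj], #S = k →
      (∀ u v, G.Adj u v → u ∈ S) → IsWeaklyDrawable G → 3 ≤ k → #G.edgeFinset + 6 ≤ 3 * k := by
  classical
  induction k with
  | zero => intros; omega
  | succ k ih =>
    intro S G _ hS hGS hG hk
    by_contra! hlt
    -- pass to a subgraph with exactly one edge too many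
    obtain ⟨H, hHG, hHcard⟩ : ∃ H ≤ G, #H.edgeFinset + 5 = 3 * (k + 1) := by
      obtain ⟨s, hs, hcard⟩ := exists_subset_card_eq
        (by omega : 3 * (k + 1) - 5 ≤ #G.edgeFinset)
      have hsG : (s : Set (Sym2 V)) ⊆ G.edgeSet := fun e he => G.mem_edgeFinset.1 (hs he)
      refine ⟨SimpleGraph.fromEdgeSet (s : Set (Sym2 V)), fun u v h => ?_, ?_⟩
      · exact hsG ((SimpleGraph.fromEdgeSet_adj _).1 h).1
      · have : ∀ _ : Fintype (SimpleGraph.fromEdgeSet (s : Set (Sym2 V))).edgeSet,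
            (SimpleGraph.fromEdgeSet (s : Set (Sym2 V))).edgeFinset = s := by
          intro _
          ext e
          rw [SimpleGraph.mem_edgeFinset, SimpleGraph.edgeSet_fromEdgeSet]
          simp only [Set.mem_sdiff, mem_coe]
          exact ⟨fun h => h.1, fun h => ⟨h, G.not_isDiag_of_mem_edgeSet (hsG h)⟩⟩
        rw [this, hcard]
        omega
    have hH := hG.mono hHG
    have hHS : ∀ u v, H.Adj u v → u ∈ S := fun u v h => hGS u v (hHG h)
    have hnbr : ∀ v, H.neighborFinset v ⊆ S.erase v := fun v w hw => by
      rw [SimpleGraph.mem_neighborFinset] at hw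
      exact mem_erase.2 ⟨hw.ne', hHS w v hw.symm⟩
    have hsum : ∑ v ∈ S, H.degree v = 2 * #H.edgeFinset := by
      rw [← H.sum_degrees_eq_twice_card_edges]
      refine sum_subset (subset_univ S) fun v _ hv => ?_
      rw [← SimpleGraph.card_neighborFinset_eq_degree, card_eq_zero, eq_empty_iff_forall_notMem]
      exact fun w hw => hv (hHS v w ((H.mem_neighborFinset v w).1 hw))
    rcases hk.eq_or_lt with hk3 | hk3
    -- Three vertices carry at most three edges, while `H` has four.
    · have : ∑ v ∈ S, H.degree v ≤ ∑ v ∈ S, 2 := by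
        refine sum_le_sum fun v hv => ?_
        rw [← SimpleGraph.card_neighborFinset_eq_degree]
        refine (card_le_card (hnbr v)).trans ?_
        rw [card_erase_of_mem hv]
        omega
      rw [sum_const, smul_eq_mul] at this
      omega
    -- every vertex has degree at least four
    have hdeg4 : ∀ v ∈ S, 4 ≤ H.degree v := by
      intro v hv
      by_contra! hlt
      have := ih (S.erase v) (H.deleteIncidenceSet v) (by rw [card_erase_of_mem hv]; omega)
        (fun u w h => by
          rw [SimpleGraph.deleteIncidenceSet_adj] at h
          exact mem_erase.2 ⟨h.2.1, hHS u w h.1⟩)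
        (hH.mono (H.deleteIncidenceSet_le v)) (by omega)
      rw [H.card_edgeFinset_deleteIncidenceSet v] at this
      omega
    -- the ends of every edge have at least three common neighbours
    have hcommon : ∀ a b, H.Adj a b → 3 ≤ #(H.neighborFinset a ∩ H.neighborFinset b) := by
      intro a b hab
      by_contra! hlt
      have := ih (S.erase b) (H.mergeInto a b)
        (by rw [card_erase_of_mem (hHS b a hab.symm)]; omega)
        (fun u w h => by
          refine mem_erase.2 ⟨h.2.1, ?_⟩
          rcases h.2.2.2 with h | h | h
          · exact hHS u w h
          · rw [h.1]; exact hHS a b hab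
          · exact hHS u b h.2)
        (hH.mergeInto hab) (by omega)
      have := H.card_edgeFinset_le_mergeInto a b hab
      omega
    -- The degree sum is `6(k + 1) - 10`.
    obtain ⟨v, hv, hv5⟩ : ∃ v ∈ S, H.degree v ≤ 5 := by
      by_contra! h
      have : ∑ v ∈ S, 6 ≤ ∑ v ∈ S, H.degree v := sum_le_sum h
      rw [sum_const, smul_eq_mul] at this
      omega
    have hN : ∀ x ∈ H.neighborFinset v, 3 ≤ #{y ∈ H.neighborFinset v | H.Adj x y} := by
      intro x hx
      refine (hcommon v x ((H.mem_neighborFinset v x).1 hx)).trans (card_le_card fun y hy => ?_)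
      simpa using hy
    have hv4 := hdeg4 v hv
    rw [← SimpleGraph.card_neighborFinset_eq_degree] at hv4 hv5
    rcases hv4.eq_or_lt with h4 | h5
    · have hclique : ∀ x ∈ H.neighborFinset v, ∀ y ∈ H.neighborFinset v, x ≠ y → H.Adj x y := by
        intro x hx y hy hxy
        have hsub : {y ∈ H.neighborFinset v | H.Adj x y} ⊆ (H.neighborFinset v).erase x :=
          fun z hz => mem_erase.2 ⟨(mem_filter.1 hz).2.ne', (mem_filter.1 hz).1⟩
        have := eq_of_subset_of_card_le hsub (by
          rw [card_erase_of_mem hx, ← h4]; exact hN x hx)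
        have hy' : y ∈ (H.neighborFinset v).erase x := mem_erase.2 ⟨hxy.symm, hy⟩
        rw [← this] at hy'
        exact (mem_filter.1 hy').2
      refine hH.cliqueFree_five (insert v (H.neighborFinset v)) ⟨?_, ?_⟩
      · have : Std.Symm H.Adj := ⟨fun _ _ h => h.symm⟩
        rw [SimpleGraph.isClique_iff, coe_insert, Set.pairwise_insert_of_symm]
        exact ⟨fun x hx y hy => hclique x hx y hy, fun x hx _ => (H.mem_neighborFinset v x).1 hx⟩
      · rw [card_insert_of_notMem (by simp), ← h4]
    -- Contracting `ac` supplies the possibly missing edge `ab`, since `c` is adjacent to `b`; then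
    -- `v, a, b, d, e` span `K₅`.
    · obtain ⟨a, ha, b, hb, c, hc, d, hd, e, he, hab, hac, had, hae, hbc, hbd, hbe, hec, hed, hcd⟩ :=
        exists_adj_of_five H _ (by omega : #(H.neighborFinset v) = 5) hN
      rw [SimpleGraph.mem_neighborFinset] at ha hb hc hd he
      refine SimpleGraph.not_cliqueFree_five_of_adj (G := H.mergeInto a c) (v := v) (a := a) (b := b)
        (c := d) (d := e) ?_ ?_ ?_ ?_ ?_ ?_ ?_ ?_ ?_ ?_ (hH.mergeInto hac).cliqueFree_five
      · exact ⟨ha.ne, hc.ne, hac.ne, .inl ha⟩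
      · exact ⟨hb.ne, hc.ne, hbc.ne, .inl hb⟩
      · exact ⟨hd.ne, hc.ne, hcd.symm, .inl hd⟩
      · exact ⟨he.ne, hc.ne, hec.ne, .inl he⟩
      · exact ⟨hab, hac.ne, hbc.ne, .inr (.inl ⟨rfl, hbc.symm⟩)⟩
      · exact ⟨had.ne, hac.ne, hcd.symm, .inl had⟩
      · exact ⟨hae.ne, hac.ne, hec.ne, .inl hae⟩
      · exact ⟨hbd.ne, hbc.ne, hcd.symm, .inl hbd⟩
      · exact ⟨hbe.ne, hbc.ne, hec.ne, .inl hbe⟩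
      · exact ⟨hed.ne', hcd.symm, hec.ne, .inl hed.symm⟩

theorem corollary1 {V : Type*} [Fintype V] (G : SimpleGraph V) [Fintype G.edgeSet] (n m : ℕ)
    (hn : Fintype.card V = n) (hm : G.edgeFinset.card = m)
    (hconn : G.Connected) (hplanar : IsPlanar G) (hn3 : 3 ≤ n) :
    (m : ℤ) ≤ 3 * (n : ℤ) - 6 := by
  classical
  have h := IsWeaklyDrawable.card_edgeFinset_add_six_le n univ G hn
    (fun u _ _ => mem_univ u) hplanar.isWeaklyDrawable hn3
  have hcard : m + 6 ≤ 3 * n := by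
    rw [← hm]
    convert h
  omega
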